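/- Let $N\ge 0$, $M\ge 1$ be integers and let $A_0,\dots,A_N:[0,1]^N\to\mathbb C^{M\times M}$ be continuous matrix functions such that $A_j=A_j(k_{j+1},\dots,k_N)$ does not depend on $k_1,\dots,k_j$. Write $\langle\cdot\rangle_j=\int_0^1\cdot\,dk_j$ and $\langle\cdot\rangle_{1,j}=\int_{[0,1]^j}\cdot\,dk_1\cdots dk_j$, and let $\mathcal A$ be the bounded operator on $L^2([0,1]^N,\mathbb C^M)$ given by $$\mathcal A u=A_0u+A_1\langle u\rangle_{1,1}+\dots+A_N\langle u\rangle_{1,N}.$$ For $\lambda\in\mathbb C$ consider the matrix-valued integral continued fractions $$F_0=A_0-\lambda I,\qquad F_j=A_j+\langle F_{j-1}^{-1}\rangle_j^{-1}\quad(1\le j\le N),$$ and the matrices $$G_0=F_0,\qquad G_j=I+\langle F_{j-1}^{-1}\rangle_jA_j\quad(1\le j\le N).$$ Here, with $S=\langle F_{j-1}^{-1}\rangle_j$, the inverse of $F_j=A_j+S^{-1}=S^{-1}G_j$ is understood as $F_j^{-1}=G_j^{-1}S$, also where the matrix $S$ is singular. Let $\sigma_0=\{\lambda:\det G_0(\lambda,k)=0\text{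 for some }k\}$, and for $j\ge1$ let $\sigma_j$ be the set of those $\lambda\in\mathbb C\setminus(\sigma_0\cup\dots\cup\sigma_{j-1})$ for which $\det G_j(\lambda,k_{j+1},\dots,k_N)=0$ for some $(k_{j+1},\dots,k_N)\in[0,1]^{N-j}$. Then: 1. The spectrum of $\mathcal A$ is $\sigma(\mathcal A)=\bigcup_{j=0}^N\sigma_j$. 2. For $0\le j\le N$ and $\lambda\notin\sigma_0\cup\dots\cup\sigma_j$ the matrices $G_0,\dots,G_j$ are invertible at every point, and the function $F_j^{-1}$ is well defined and continuous (so that, for $j<N$, $G_{j+1}$ is well defined). 3. Let $1\le j\le N$ and $\lambda\notin\sigma_0\cup\dots\cup\sigma_{j-1}$, and suppose that, with the fractions $F_0,\dots,F_{j-1}$ read literally, the matrices $\langle F_{r-1}^{-1}\rangle_r$, $1\le r\le j-1$, are invertible at every point. Then the literal matrix $F_{j-1}$ is invertible at every point, its inverse is the function $F_{j-1}^{-1}$ above, $G_j=I+\langle F_{j-1}^{-1}\rangle_jA_j$ with this literal inverse, and $G_j=\langle F_{j-1}^{-1}\rangle_jF_j$ at every point where $\langle F_{j-1}^{-1}\rangle_j$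 is invertible. -/

import Mathlib

open MeasureTheory
open scoped ENNReal

noncomputable section

namespace ContinuedFraction

/-- The cube `[0,1]^N`; its `volume` is the product of the Lebesgue measures.  The variable
`k_{i+1}` of the usual numbering is the coordinate `k i`, for `i : Fin N`. -/
abbrev Cube (N : ℕ) : Type := Fin N → unitInterval

/-- The Hilbert space `L²([0,1]^N, ℂ^M)`. -/
abbrev L2 (N M : ℕ) : Type :=
  Lp (EuclideanSpace ℂ (Fin M)) 2 (volume : Measure (Cube N))

variable {N M : ℕ}

/-- The point of the cube with first `j` coordinates taken from `s`, the others from `k`. -/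
def glue (j : ℕ) (s k : Cube N) : Cube N := fun i => if (i : ℕ) < j then s i else k i

lemma measurePreserving_glue (j : ℕ) :
    MeasurePreserving (fun p : Cube N × Cube N => glue j p.2 p.1)
      ((volume : Measure (Cube N)).prod volume) volume := by
  have h1 := (volume_measurePreserving_arrowProdEquivProdArrow
    unitInterval unitInterval (Fin N)).symm
  have h2 : MeasurePreserving
      (fun (a : Fin N → unitInterval × unitInterval) (i : Fin N) =>
        (if (i : ℕ) < j then Prod.snd else Prod.fst) (a i)) volume volume := by
    refine measurePreserving_pi _ _
      (f := fun (i : Fin N) (x : unitInterval × unitInterval) =>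
        (if (i : ℕ) < j then Prod.snd else Prod.fst) x) fun i => ?_
    split_ifs
    · exact measurePreserving_snd
    · exact measurePreserving_fst
  have h3 := h2.comp h1
  have h4 : (fun p : Cube N × Cube N => glue j p.2 p.1) =
      (fun (a : Fin N → unitInterval × unitInterval) (i : Fin N) =>
        (if (i : ℕ) < j then Prod.snd else Prod.fst) (a i)) ∘
      (MeasurableEquiv.arrowProdEquivProdArrow unitInterval unitInterval (Fin N)).symm := by
    funext p i
    change _ = (if (i : ℕ) < j then Prod.snd else Prod.fst) (p.1 i, p.2 i)
    simp only [glue]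
    split_ifs <;> rfl
  rw [h4]
  exact h3

/-- The partial integral `⟨u⟩_{1,j}`, that is the integral over the first `j` variables.  (The
integral over the whole cube of a function of the first `j` variables is the integral over
`[0,1]^j`, all the measures having mass one.) -/
def partialAvg {E : Type*} [NormedAddCommGroup E] [NormedSpace ℝ E]
    (j : ℕ) (u : Cube N → E) (k : Cube N) : E :=
  ∫ s : Cube N, u (glue j s k)

lemma memLp_glue {E : Type*} [NormedAddCommGroup E] (j : ℕ) {u : Cube N → E} (hu : MemLp u 2 volume) :
    MemLp (fun p : Cube N × Cube N => u (glue j p.2 p.1)) 2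
      ((volume : Measure (Cube N)).prod volume) :=
  hu.comp_measurePreserving (measurePreserving_glue j)

lemma sq_eLpNorm_two {α E : Type*} [NormedAddCommGroup E] [MeasurableSpace α] (μ : Measure α) (f : α → E) :
    eLpNorm f 2 μ ^ 2 = ∫⁻ x, ‖f x‖ₑ ^ 2 ∂μ := by
  have := eLpNorm_nnreal_pow_eq_lintegral (μ := μ) (f := f) (p := 2) (by norm_num)
  simpa using this

lemma integrable_glue {E : Type*} [NormedAddCommGroup E] (j : ℕ) {u : Cube N → E} (hu : MemLp u 2 volume) :
    ∀ᵐ k : Cube N, Integrable (fun s : Cube N => u (glue j s k)) :=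
  ((memLp_glue j hu).integrable (by norm_num)).prod_right_ae

section PartialAverageOperator

variable {E : Type*} [NormedAddCommGroup E] [NormedSpace ℝ E]

lemma partialAvg_congr (j : ℕ) {u v : Cube N → E} (h : u =ᵐ[volume] v) :
    partialAvg j u =ᵐ[volume] partialAvg j v := by
  have h1 := Measure.ae_ae_of_ae_prod
    ((measurePreserving_glue j).quasiMeasurePreserving.ae h)
  filter_upwards [h1] with k hk
  exact integral_congr_ae hk

lemma eLpNorm_partialAvg_le (j : ℕ) {u : Cube N → E} (hu : MemLp u 2 volume) :
    eLpNorm (partialAvg j u) 2 volume ≤ eLpNorm u 2 volume := by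
  have hm := memLp_glue j hu
  have he := eLpNorm_comp_measurePreserving (p := 2) hu.1 (measurePreserving_glue j)
  change eLpNorm (fun p : Cube N × Cube N => u (glue j p.2 p.1)) 2 _ = _ at he
  rw [← he, ← ENNReal.pow_le_pow_left_iff (n := 2) (by norm_num), sq_eLpNorm_two, sq_eLpNorm_two,
    lintegral_prod _ (hm.1.enorm.pow_const 2)]
  refine lintegral_mono_ae ?_
  filter_upwards [integrable_glue j hu] with k hk
  have h1 : ‖partialAvg j u k‖ₑ ≤ eLpNorm (fun s : Cube N => u (glue j s k)) 2 volume := by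
    refine (enorm_integral_le_lintegral_enorm _).trans ?_
    rw [← eLpNorm_one_eq_lintegral_enorm]
    exact eLpNorm_le_eLpNorm_of_exponent_le (by norm_num) hk.1
  calc ‖partialAvg j u k‖ₑ ^ 2
      ≤ eLpNorm (fun s : Cube N => u (glue j s k)) 2 volume ^ 2 := by gcongr
    _ = _ := sq_eLpNorm_two _ _

lemma memLp_partialAvg (j : ℕ) {u : Cube N → E} (hu : MemLp u 2 volume) :
    MemLp (partialAvg j u) 2 volume :=
  ⟨(memLp_glue j hu).1.integral_prod_right',
    (eLpNorm_partialAvg_le j hu).trans_lt hu.2⟩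

end PartialAverageOperator

/-- The bounded operator `⟨·⟩_{1,j}` on `L²([0,1]^N, ℂ^M)`. -/
def avgOp (j : ℕ) : L2 N M →L[ℂ] L2 N M :=
  LinearMap.mkContinuous
    { toFun := fun u => (memLp_partialAvg j (Lp.memLp u)).toLp _
      map_add' := fun u v => by
        rw [← MemLp.toLp_add]
        refine MemLp.toLp_congr _ _ ((partialAvg_congr j (Lp.coeFn_add u v)).trans ?_)
        filter_upwards [integrable_glue j (Lp.memLp u), integrable_glue j (Lp.memLp v)]
          with k hu hv
        exact integral_add hu hv
      map_smul' := fun c u => by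
        rw [RingHom.id_apply, ← MemLp.toLp_const_smul]
        refine MemLp.toLp_congr _ _ ((partialAvg_congr j (Lp.coeFn_smul c u)).trans ?_)
        filter_upwards with k
        exact integral_smul c _ }
    1 fun u => by
      rw [one_mul]
      change ‖(memLp_partialAvg j (Lp.memLp u)).toLp _‖ ≤ ‖u‖
      rw [Lp.norm_toLp, Lp.norm_def]
      exact ENNReal.toReal_mono (Lp.eLpNorm_ne_top u) (eLpNorm_partialAvg_le j (Lp.memLp u))

lemma avgOp_ae (j : ℕ) (u : L2 N M) : avgOp j u =ᵐ[volume] partialAvg j u :=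
  MemLp.coeFn_toLp (memLp_partialAvg j (Lp.memLp u))

/-- A continuous matrix function as a continuous operator-valued function. -/
def matrixToCLM (A : C(Cube N, Matrix (Fin M) (Fin M) ℂ)) :
    C(Cube N, EuclideanSpace ℂ (Fin M) →L[ℂ] EuclideanSpace ℂ (Fin M)) where
  toFun k := Matrix.toEuclideanCLM (n := Fin M) (𝕜 := ℂ) (A k)
  continuous_toFun :=
    (LinearMap.continuous_of_finiteDimensional
      (Matrix.toEuclideanCLM (n := Fin M) (𝕜 := ℂ)).toAlgEquiv.toLinearMap).comp A.continuous

/-- The bounded operator `u ↦ A(·) u(·)` of multiplication by a continuous matrix function. -/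
def mulOp (A : C(Cube N, Matrix (Fin M) (Fin M) ℂ)) : L2 N M →L[ℂ] L2 N M :=
  (ContinuousLinearMap.id ℂ
    (EuclideanSpace ℂ (Fin M) →L[ℂ] EuclideanSpace ℂ (Fin M))).holderL volume ∞ 2 2
      (ContinuousMap.toLp ∞ volume ℂ (matrixToCLM A))

lemma mulOp_ae (A : C(Cube N, Matrix (Fin M) (Fin M) ℂ)) (u : L2 N M) :
    mulOp A u =ᵐ[volume] fun k => WithLp.toLp 2 ((A k).mulVec (u k).ofLp) := by
  have h1 := (ContinuousLinearMap.id ℂ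
    (EuclideanSpace ℂ (Fin M) →L[ℂ] EuclideanSpace ℂ (Fin M))).coeFn_holder (r := 2)
      (ContinuousMap.toLp ∞ (volume : Measure (Cube N)) ℂ (matrixToCLM A)) u
  refine Filter.EventuallyEq.trans h1 ?_
  filter_upwards [ContinuousMap.coeFn_toLp (p := ∞) (volume : Measure (Cube N)) (𝕜 := ℂ)
    (matrixToCLM A)] with k hk
  rw [hk]
  rfl

/-- The operator `𝒜 = A₀ · + A₁ ⟨·⟩_{1,1} + … + A_N ⟨·⟩_{1,N}` on `L²([0,1]^N, ℂ^M)`. -/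
def defectOp (A : Fin (N + 1) → C(Cube N, Matrix (Fin M) (Fin M) ℂ)) : L2 N M →L[ℂ] L2 N M :=
  mulOp (A 0) + ∑ j : Fin N, (mulOp (A j.succ)).comp (avgOp ((j : ℕ) + 1))

/-- The integral of a matrix function over the single variable `k i`, entry by entry. -/
def coordAvg (i : Fin N) (F : Cube N → Matrix (Fin M) (Fin M) ℂ) (k : Cube N) :
    Matrix (Fin M) (Fin M) ℂ :=
  Matrix.of fun a b => ∫ t : unitInterval, F (Function.update k i t) a b

/-- The continued fractions `F₀ = A₀ - λ I`, `F_{j} = A_{j} + ⟨F_{j-1}⁻¹⟩_{j}⁻¹`, read literally: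
meaningful where all the matrices that are inverted are invertible. -/
def F (A : Fin (N + 1) → C(Cube N, Matrix (Fin M) (Fin M) ℂ)) (z : ℂ) :
    Fin (N + 1) → Cube N → Matrix (Fin M) (Fin M) ℂ :=
  Fin.induction (motive := fun _ => Cube N → Matrix (Fin M) (Fin M) ℂ)
    (fun k => A 0 k - z • (1 : Matrix (Fin M) (Fin M) ℂ))
    (fun i Fi k => A i.succ k + (coordAvg i (fun k' => (Fi k')⁻¹) k)⁻¹)

/-- The inverses `F_j⁻¹` of the continued fractions.  With `S = ⟨F_{j-1}⁻¹⟩_j` one has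
`F_j = A_j + S⁻¹ = S⁻¹ (I + S A_j)`, whence `F_j⁻¹ = (I + S A_j)⁻¹ S`.  The last expression is
taken as the value of `F_j⁻¹`, so that it makes sense also where `S` is singular (and there
`F_j` itself is infinite in some directions). -/
def invF (A : Fin (N + 1) → C(Cube N, Matrix (Fin M) (Fin M) ℂ)) (z : ℂ) :
    Fin (N + 1) → Cube N → Matrix (Fin M) (Fin M) ℂ :=
  Fin.induction (motive := fun _ => Cube N → Matrix (Fin M) (Fin M) ℂ)
    (fun k => (A 0 k - z • (1 : Matrix (Fin M) (Fin M) ℂ))⁻¹)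
    (fun i Ri k => (1 + coordAvg i Ri k * A i.succ k)⁻¹ * coordAvg i Ri k)

/-- The matrices `G₀ = F₀`, `G_j = I + ⟨F_{j-1}⁻¹⟩_j A_j`. -/
def G (A : Fin (N + 1) → C(Cube N, Matrix (Fin M) (Fin M) ℂ)) (z : ℂ) :
    Fin (N + 1) → Cube N → Matrix (Fin M) (Fin M) ℂ :=
  Fin.cases (motive := fun _ => Cube N → Matrix (Fin M) (Fin M) ℂ)
    (fun k => A 0 k - z • (1 : Matrix (Fin M) (Fin M) ℂ))
    (fun i k => 1 + coordAvg i (invF A z i.castSucc) k * A i.succ k)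

/-- The spectral component `σ_j`: the `z` with `det G_j(z, k) = 0` for some `k`, among the `z`
for which `G_j(z, ·)` is defined, namely those outside `σ_0, …, σ_{j-1}`. -/
def sigma (A : Fin (N + 1) → C(Cube N, Matrix (Fin M) (Fin M) ℂ)) (j : Fin (N + 1)) : Set ℂ :=
  {z | (∀ r < j, ∀ k, (G A z r k).det ≠ 0) ∧ ∃ k, (G A z j k).det = 0}

end ContinuedFraction

end

open MeasureTheory
open scoped ENNReal

noncomputable section

namespace ContinuedFraction

/-! ### Averages and multiplications on continuous functions -/

section ContinuousFunctions

variable {N M : ℕ}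

/-! Write `P_j` for the average over the first `j` variables and `T_j` for `A₀ - z + A₁ P_1 + … +
A_j P_j`, so that `T_N = 𝒜 - z` and `T_j = T_{j-1} + A_j P_j`. The `P_j` are projections with
decreasing ranges, and `P_j` commutes with multiplication by `A_j`.

Invertibility passes from `T_{j-1}` to `T_j` by the Woodbury identity. The inductive invariant is
that `P_{j-1} T_{j-1}⁻¹ P_{j-1}` is multiplication by `F_{j-1}⁻¹` on the range of `P_{j-1}`.
Compressing further to the range of `P_j` averages this symbol over `k_j` and gives multiplication
by `S = ⟨F_{j-1}⁻¹⟩_j`. If `G_j = I + S A_j` is invertible everywhere, then `T_j` is invertible and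
its inverse compresses to `G_j⁻¹ S = F_j⁻¹` (`woodbury_of_compression`, `partialOp_inverse`). No
inverse of `S` is needed.

If instead `G_j` is singular at a point after `G_0, …, G_{j-1}` were invertible, take a kernel
vector times bumps near that point, of mean zero in each of `k_{j+1}, …, k_N`. These functions are
fixed by `P_j`, killed by all later averages, and almost annihilated by `G_j`
(`exists_norm_mulOp_le`). An inverse of `T_N` would bound `G_j` from below on them
(`exists_reduction`, `not_isUnit_partialOp_last`). -/

lemma continuous_glue (j : ℕ) :
    Continuous fun p : Cube N × Cube N => glue j p.2 p.1 := by
  refine continuous_pi fun i => ?_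
  simp only [glue]
  split_ifs <;> fun_prop

lemma glue_glue_of_le {j r : ℕ} (h : j ≤ r) (s t k : Cube N) :
    glue r t (glue j s k) = glue r t k := by
  funext i
  simp only [glue]
  split_ifs <;> first | rfl | omega

lemma glue_glue_of_ge {j r : ℕ} (h : r ≤ j) (s t k : Cube N) :
    glue r t (glue j s k) = glue j (glue r t s) k := by
  funext i
  simp only [glue]
  split_ifs <;> first | rfl | omega

lemma glue_apply_of_le (j : ℕ) (s k : Cube N) {i : Fin N} (h : j ≤ (i : ℕ)) :
    glue j s k i = k i := by
  simp [glue, Nat.not_lt.mpr h]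

lemma _root_.Continuous.integrable_cube {E : Type*} [NormedAddCommGroup E] {n : ℕ}
    {f : Cube n → E} (hf : Continuous f) : Integrable f :=
  hf.integrable_of_hasCompactSupport (HasCompactSupport.of_compactSpace f)

/-- The partial average of a continuous function, as a continuous function. -/
def avgC (j : ℕ) (f : C(Cube N, EuclideanSpace ℂ (Fin M))) :
    C(Cube N, EuclideanSpace ℂ (Fin M)) where
  toFun := partialAvg j f
  continuous_toFun := by
    have h := continuous_parametric_integral_of_continuous (μ := (volume : Measure (Cube N)))
      (f := fun k s : Cube N => f (glue j s k)) (f.continuous.comp (continuous_glue j))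
      isCompact_univ
    simp only [Measure.restrict_univ] at h
    exact h

lemma avgC_apply (j : ℕ) (f : C(Cube N, EuclideanSpace ℂ (Fin M))) (k : Cube N) :
    avgC j f k = ∫ s : Cube N, f (glue j s k) := rfl

/-- The product of a continuous matrix function and a continuous vector function. -/
def mulC (B : C(Cube N, Matrix (Fin M) (Fin M) ℂ)) (f : C(Cube N, EuclideanSpace ℂ (Fin M))) :
    C(Cube N, EuclideanSpace ℂ (Fin M)) where
  toFun k := Matrix.toEuclideanCLM (n := Fin M) (𝕜 := ℂ) (B k) (f k)
  continuous_toFun := (matrixToCLM B).continuous.clm_apply f.continuous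

lemma mulC_apply (B : C(Cube N, Matrix (Fin M) (Fin M) ℂ)) (f : C(Cube N, EuclideanSpace ℂ (Fin M)))
    (k : Cube N) : mulC B f k = Matrix.toEuclideanCLM (n := Fin M) (𝕜 := ℂ) (B k) (f k) := rfl

/-- The class in `L²` of a continuous function. -/
abbrev ofC : C(Cube N, EuclideanSpace ℂ (Fin M)) →L[ℂ] L2 N M := ContinuousMap.toLp 2 volume ℂ

lemma ofC_ae (f : C(Cube N, EuclideanSpace ℂ (Fin M))) : ofC f =ᵐ[volume] f :=
  ContinuousMap.coeFn_toLp _ f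

lemma avgOp_ofC (j : ℕ) (f : C(Cube N, EuclideanSpace ℂ (Fin M))) :
    avgOp j (ofC f) = ofC (avgC j f) :=
  Lp.ext ((avgOp_ae j _).trans ((partialAvg_congr j (ofC_ae f)).trans (ofC_ae (avgC j f)).symm))

lemma mulOp_ofC (B : C(Cube N, Matrix (Fin M) (Fin M) ℂ))
    (f : C(Cube N, EuclideanSpace ℂ (Fin M))) : mulOp B (ofC f) = ofC (mulC B f) := by
  refine Lp.ext ((mulOp_ae B _).trans ?_)
  filter_upwards [ofC_ae f, ofC_ae (mulC B f)] with k h1 h2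
  rw [h1, h2]
  rfl

/-- Continuous functions are dense in `L²`. Operator identities thus reduce to pointwise ones, free
of null sets. -/
lemma clm_ext_ofC {S T : L2 N M →L[ℂ] L2 N M} (h : ∀ f, S (ofC f) = T (ofC f)) : S = T := by
  have hd : DenseRange (ofC (N := N) (M := M)) :=
    ContinuousMap.toLp_denseRange _ _ _ (by simp)
  exact ContinuousLinearMap.ext fun u =>
    congrFun (hd.equalizer S.continuous T.continuous (funext h)) u

end ContinuousFunctions

/-! ### Algebra of multiplication operators and averages -/

section OperatorAlgebra

variable {N M : ℕ}

lemma mulOp_mul (B C : C(Cube N, Matrix (Fin M) (Fin M) ℂ)) :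
    mulOp (B * C) = mulOp B * mulOp C :=
  clm_ext_ofC fun f => by
    simp only [mul_apply_eq_comp, mulOp_ofC]
    congr 1
    ext1 k
    simp [mulC_apply]

lemma mulOp_add (B C : C(Cube N, Matrix (Fin M) (Fin M) ℂ)) :
    mulOp (B + C) = mulOp B + mulOp C :=
  clm_ext_ofC fun f => by
    simp only [add_apply, mulOp_ofC, ← map_add]
    congr 1
    ext1 k
    simp [mulC_apply]

lemma mulOp_one : mulOp (1 : C(Cube N, Matrix (Fin M) (Fin M) ℂ)) = 1 :=
  clm_ext_ofC fun f => by
    simp only [one_apply_eq_self, mulOp_ofC]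
    congr 1
    ext1 k
    simp [mulC_apply]

lemma mulOp_sub (B C : C(Cube N, Matrix (Fin M) (Fin M) ℂ)) :
    mulOp (B - C) = mulOp B - mulOp C := by
  rw [eq_sub_iff_add_eq, ← mulOp_add, sub_add_cancel]

lemma mulOp_smul (c : ℂ) (B : C(Cube N, Matrix (Fin M) (Fin M) ℂ)) :
    mulOp (c • B) = c • mulOp B :=
  clm_ext_ofC fun f => by
    simp only [smul_apply, mulOp_ofC, ← map_smul]
    congr 1
    ext1 k
    simp [mulC_apply]

lemma avgOp_zero : avgOp (N := N) (M := M) 0 = 1 :=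
  clm_ext_ofC fun f => by
    simp only [one_apply_eq_self, avgOp_ofC]
    congr 1
    ext1 k
    have h : ∀ s : Cube N, glue 0 s k = k := fun s => by funext i; simp [glue]
    simp [avgC_apply, h]

lemma avgOp_mul_of_le {j r : ℕ} (h : j ≤ r) :
    avgOp (N := N) (M := M) j * avgOp r = avgOp r :=
  clm_ext_ofC fun f => by
    simp only [mul_apply_eq_comp, avgOp_ofC]
    congr 1
    ext1 k
    simp [avgC_apply, glue_glue_of_le h]

/-- The inner average only resamples variables that the outer one integrates anyway; by Fubini this
changes nothing. -/
lemma avgOp_mul_of_ge {j r : ℕ} (h : r ≤ j) :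
    avgOp (N := N) (M := M) j * avgOp r = avgOp j :=
  clm_ext_ofC fun f => by
    simp only [mul_apply_eq_comp, avgOp_ofC]
    congr 1
    ext1 k
    simp only [avgC_apply, glue_glue_of_ge h]
    have hc : Continuous fun s : Cube N => f (glue j s k) :=
      f.continuous.comp ((continuous_glue j).comp (by fun_prop : Continuous fun s => (k, s)))
    have hi := (hc.comp (continuous_glue (N := N) r)).integrable_of_hasCompactSupport
      (μ := (volume : Measure (Cube N)).prod volume) (HasCompactSupport.of_compactSpace _)
    have h1 := integral_prod _ hi
    have hm := measurePreserving_glue (N := N) r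
    -- Gluing two independent uniform points gives a uniform point, so the double integral collapses
    -- to a single one.
    have h2 := integral_map (μ := (volume : Measure (Cube N)).prod volume)
      hm.measurable.aemeasurable (f := fun s : Cube N => f (glue j s k))
      hc.aestronglyMeasurable
    rw [hm.map_eq] at h2
    exact (h2.trans h1).symm

/-- Multiplication by a matrix function that does not depend on the first `j` variables commutes
with the average over these variables. -/
lemma avgOp_mul_mulOp {j : ℕ} {B : C(Cube N, Matrix (Fin M) (Fin M) ℂ)}
    (hB : DependsOn B {i : Fin N | j ≤ (i : ℕ)}) :
    avgOp j * mulOp B = mulOp B * avgOp j :=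
  clm_ext_ofC fun f => by
    simp only [mul_apply_eq_comp, avgOp_ofC, mulOp_ofC]
    congr 1
    ext1 k
    have h : ∀ s : Cube N, B (glue j s k) = B k := fun s =>
      hB fun i hi => glue_apply_of_le j s k hi
    simp only [avgC_apply, mulC_apply, h]
    exact ContinuousLinearMap.integral_comp_comm _ (Continuous.integrable_cube
      (f.continuous.comp ((continuous_glue j).comp (by fun_prop : Continuous fun s => (k, s)))))

lemma continuous_coordAvg (i : Fin N) {R : Cube N → Matrix (Fin M) (Fin M) ℂ}
    (hR : Continuous R) : Continuous (coordAvg i R) := by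
  refine continuous_matrix fun a b => ?_
  have hc : Continuous fun p : Cube N × unitInterval => R (Function.update p.1 i p.2) a b :=
    (hR.comp (continuous_fst.update i continuous_snd)).matrix_elem a b
  have h := continuous_parametric_integral_of_continuous
    (μ := (volume : Measure unitInterval))
    (f := fun (k : Cube N) t => R (Function.update k i t) a b) hc isCompact_univ
  simp only [Measure.restrict_univ] at h
  exact h

lemma dependsOn_coordAvg {i : Fin N} {R : Cube N → Matrix (Fin M) (Fin M) ℂ}
    (hR : DependsOn R {l : Fin N | (i : ℕ) ≤ l}) :
    DependsOn (coordAvg i R) {l : Fin N | (i : ℕ) + 1 ≤ l} := by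
  intro k k' h
  have : ∀ t, R (Function.update k i t) = R (Function.update k' i t) := fun t => by
    refine hR fun l hl => ?_
    rcases eq_or_ne l i with rfl | hne
    · simp
    · have hl' : (i : ℕ) ≤ l := hl
      have : (l : ℕ) ≠ i := fun h => hne (Fin.ext h)
      simpa [hne] using h l (by simp; omega)
  simp only [coordAvg, this]

lemma integral_eval {E : Type*} [NormedAddCommGroup E] [NormedSpace ℝ E] (i : Fin N)
    {g : unitInterval → E} (hg : Continuous g) : ∫ s : Cube N, g (s i) = ∫ t, g t := by
  have hm : MeasurePreserving (Function.eval i) (volume : Measure (Cube N)) volume :=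
    measurePreserving_eval (fun _ => volume) i
  have h := integral_map (μ := (volume : Measure (Cube N))) hm.measurable.aemeasurable (f := g)
    (hm.map_eq ▸ hg.aestronglyMeasurable)
  rw [hm.map_eq] at h
  exact h.symm

lemma toEuclideanCLM_coordAvg (i : Fin N) {R : Cube N → Matrix (Fin M) (Fin M) ℂ}
    (hR : Continuous R) (k : Cube N) (v : EuclideanSpace ℂ (Fin M)) :
    Matrix.toEuclideanCLM (n := Fin M) (𝕜 := ℂ) (coordAvg i R k) v =
      ∫ t : unitInterval,
        Matrix.toEuclideanCLM (n := Fin M) (𝕜 := ℂ) (R (Function.update k i t)) v := by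
  have hc : Continuous fun t : unitInterval => R (Function.update k i t) :=
    hR.comp (continuous_const.update i continuous_id)
  have hint : ∀ {E : Type} [NormedAddCommGroup E] {g : unitInterval → E}, Continuous g →
      Integrable g := fun hg =>
    hg.integrable_of_hasCompactSupport (HasCompactSupport.of_compactSpace _)
  have hLc : Continuous fun t : unitInterval =>
      Matrix.toEuclideanCLM (n := Fin M) (𝕜 := ℂ) (R (Function.update k i t)) v :=
    ((LinearMap.continuous_of_finiteDimensional
      (Matrix.toEuclideanCLM (n := Fin M) (𝕜 := ℂ)).toAlgEquiv.toLinearMap).comp hc).clm_apply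
      continuous_const
  ext a
  have h := (EuclideanSpace.proj a : EuclideanSpace ℂ (Fin M) →L[ℂ] ℂ).integral_comp_comm
    (hint hLc)
  refine Eq.trans ?_ h
  refine Eq.trans ?_ (integral_finsetSum (μ := (volume : Measure unitInterval)) Finset.univ
    (f := fun b t => R (Function.update k i t) a b * v b)
    fun b _ => hint ((hc.matrix_elem a b).mul continuous_const)).symm
  simp only [integral_mul_const]
  rfl

/-- Compressing multiplication by `R` to the functions that do not depend on the first `i + 1`
variables gives multiplication by the average of `R`. -/
lemma avgOp_mul_mulOp_mul_avgOp (i : Fin N) {R S : C(Cube N, Matrix (Fin M) (Fin M) ℂ)}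
    (hR : DependsOn R {l : Fin N | (i : ℕ) ≤ l}) (hS : ∀ k, S k = coordAvg i R k) :
    avgOp ((i : ℕ) + 1) * mulOp R * avgOp ((i : ℕ) + 1) =
      mulOp S * avgOp ((i : ℕ) + 1) :=
  clm_ext_ofC fun f => by
    simp only [mul_apply_eq_comp, avgOp_ofC, mulOp_ofC]
    congr 1
    ext1 k
    simp only [avgC_apply, mulC_apply, glue_glue_of_le le_rfl, hS]
    rw [toEuclideanCLM_coordAvg i R.continuous]
    -- Since `R` ignores the variables before the index `i`, the only integrated variable it sees is
    -- `s i`; the averaged `f` is already constant in `s`.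
    have h : ∀ s : Cube N, R (glue ((i : ℕ) + 1) s k) = R (Function.update k i (s i)) :=
      fun s => hR fun l hl => by
        have hl' : (i : ℕ) ≤ l := hl
        rcases eq_or_ne l i with rfl | hne
        · simp [glue]
        · have : (l : ℕ) ≠ i := fun h => hne (Fin.ext h)
          rw [glue_apply_of_le _ _ _ (by omega), Function.update_of_ne hne]
    simp only [h]
    refine integral_eval i (g := fun t => Matrix.toEuclideanCLM (n := Fin M) (𝕜 := ℂ)
      (R (Function.update k i t)) (∫ s, f (glue ((i : ℕ) + 1) s k))) ?_
    exact ((matrixToCLM R).continuous.comp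
      (continuous_const.update i continuous_id)).clm_apply continuous_const

end OperatorAlgebra

/-! ### Mean-zero test functions concentrated near a singular point -/

section TestFunctions

variable {N M : ℕ}

/-- A nonempty relatively open set, even one at an endpoint, meets the open interval `(0, 1)`. This
makes bumps have positive integral and continuous functions embed into `L²`. -/
instance : (volume : Measure unitInterval).IsOpenPosMeasure where
  open_pos U hU hne := by
    obtain ⟨V, hV, rfl⟩ := isOpen_induced_iff.mp hU
    obtain ⟨x, hx⟩ := hne
    rw [Measure.Subtype.volume_def, comap_subtype_coe_apply measurableSet_Icc,
      Subtype.image_preimage_coe]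
    have hx' : (x : ℝ) ∈ closure (Set.Ioo (0 : ℝ) 1) := by
      rw [closure_Ioo zero_ne_one]
      exact x.2
    have h := mem_closure_iff.mp hx' V hV hx
    have hsub : V ∩ Set.Ioo 0 1 ⊆ unitInterval ∩ V := fun y hy =>
      ⟨Set.Ioo_subset_Icc_self hy.2, hy.1⟩
    exact ((hV.inter isOpen_Ioo).measure_pos volume h).ne' ∘ measure_mono_null hsub

/-- There are continuous functions of mean zero supported near any point of the interval. -/
lemma exists_meanZero_bump (t₀ : unitInterval) {δ : ℝ} (hδ : 0 < δ) :
    ∃ g : C(unitInterval, ℂ), (∀ t, g t ≠ 0 → dist t t₀ < δ) ∧ ∫ t, g t = 0 ∧ ∃ t, g t ≠ 0 := by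
  set b : unitInterval → ℝ := fun t => max 0 (δ - dist t t₀) with hb
  have hbc : Continuous b := by fun_prop
  have hint : ∀ {f : unitInterval → ℝ}, Continuous f → Integrable f := fun hf =>
    hf.integrable_of_hasCompactSupport (HasCompactSupport.of_compactSpace _)
  have hpos : 0 < ∫ t, b t := by
    refine hbc.integral_pos_of_hasCompactSupport_nonneg_nonzero (x := t₀)
      (HasCompactSupport.of_compactSpace _) (fun t => le_max_left _ _) ?_
    simpa [hb] using hδ
  -- The mean of `t` with respect to the weight `b`, so that `(t - c) * b t` integrates to zero.
  set c : ℝ := (∫ t : unitInterval, (t : ℝ) * b t) / ∫ t, b t with hc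
  have hbt : Continuous fun t : unitInterval => (t : ℝ) * b t :=
    continuous_subtype_val.mul hbc
  have hcb : Continuous fun t : unitInterval => c * b t := continuous_const.mul hbc
  refine ⟨⟨fun t => (((t : ℝ) * b t - c * b t : ℝ) : ℂ), Complex.continuous_ofReal.comp
    (hbt.sub hcb)⟩, fun t ht => ?_, ?_, ?_⟩
  · by_contra hd
    have : b t = 0 := max_eq_left (by linarith [not_lt.mp hd])
    simp [this] at ht
  · change ∫ t : unitInterval, (((t : ℝ) * b t - c * b t : ℝ) : ℂ) = 0
    rw [integral_complex_ofReal, integral_sub (hint hbt) (hint hcb),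
      integral_const_mul, hc, div_mul_cancel₀ _ hpos.ne', sub_self, Complex.ofReal_zero]
  · by_contra! h
    have hz : ∀ t : unitInterval, ((t : ℝ) - c) * b t = 0 := fun t => by
      have := h t
      rw [ContinuousMap.coe_mk, Complex.ofReal_eq_zero] at this
      linarith
    -- If `(t - c) * b t` vanished identically, `b` would live on the single point `c`, a null set,
    -- against `hpos`.
    have hs : {t : unitInterval | b t ≠ 0}.Subsingleton := fun s hs t ht =>
      Subtype.ext (by
        have h1 := (mul_eq_zero.mp (hz s)).resolve_right hs
        have h2 := (mul_eq_zero.mp (hz t)).resolve_right ht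
        linarith)
    have h0 : b =ᵐ[volume] 0 := by
      have := hs.measure_zero (volume : Measure unitInterval)
      exact this
    rw [integral_congr_ae h0] at hpos
    simp at hpos

/-- If the matrix function `B` of the variables from the index `j` on is singular somewhere, then
multiplication by it is not bounded below on the functions of these variables that have mean zero
in the first of them. -/
lemma exists_norm_mulOp_le {j : ℕ} {B : C(Cube N, Matrix (Fin M) (Fin M) ℂ)}
    (hB : DependsOn B {i : Fin N | j ≤ (i : ℕ)}) {k₀ : Cube N} (hdet : (B k₀).det = 0)
    {ε : ℝ} (hε : 0 < ε) :
    ∃ u : L2 N M, u ≠ 0 ∧ avgOp j u = u ∧ (∀ r, j < r → r ≤ N → avgOp r u = 0) ∧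
      ‖mulOp B u‖ ≤ ε * ‖u‖ := by
  obtain ⟨w, hw0, hw⟩ := Matrix.exists_mulVec_eq_zero_iff.mpr hdet
  set v : EuclideanSpace ℂ (Fin M) := WithLp.toLp 2 w with hv
  have hv0 : v ≠ 0 := fun h => hw0 (by simpa [hv] using h)
  have hBv : Matrix.toEuclideanCLM (n := Fin M) (𝕜 := ℂ) (B k₀) v = 0 := by
    rw [hv, Matrix.toEuclideanCLM_toLp, hw, WithLp.toLp_zero]
  have hcont : Continuous fun k => Matrix.toEuclideanCLM (n := Fin M) (𝕜 := ℂ) (B k) v :=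
    (matrixToCLM B).continuous.clm_apply continuous_const
  obtain ⟨δ, hδ, hδB⟩ := Metric.continuousAt_iff.mp (hcont.continuousAt (x := k₀)) (ε * ‖v‖)
    (mul_pos hε (norm_pos_iff.mpr hv0))
  choose g hgs hg0 t ht using fun i => exists_meanZero_bump (k₀ i) hδ
  -- Constant factors in the first `j` variables make `avgOp j` fix the product; mean-zero factors
  -- in the others make every longer average kill it.
  set h : Fin N → C(unitInterval, ℂ) := fun i => if (i : ℕ) < j then 1 else g i with hh
  have hlt : ∀ i : Fin N, (i : ℕ) < j → h i = 1 := fun i hi => if_pos hi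
  have hge : ∀ i : Fin N, j ≤ (i : ℕ) → h i = g i := fun i hi => if_neg (not_lt.mpr hi)
  set φ : Cube N → ℂ := fun k => ∏ i, h i (k i) with hφ
  have hφc : Continuous φ :=
    continuous_finsetProd _ fun i _ => (h i).continuous.comp (continuous_apply i)
  set f : C(Cube N, EuclideanSpace ℂ (Fin M)) :=
    ⟨fun k => φ k • v, hφc.smul continuous_const⟩ with hf
  have hfk : ∀ k, f k = φ k • v := fun _ => rfl
  refine ⟨ofC f, ?_, ?_, fun r hr hrN => ?_, ?_⟩
  · intro h0
    have hf0 : f = 0 := ContinuousMap.toLp_injective (p := 2) (𝕜 := ℂ)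
      (volume : Measure (Cube N)) (h0.trans (map_zero _).symm)
    have h1 : φ t • v = 0 := by rw [← hfk, hf0]; rfl
    refine (smul_ne_zero (Finset.prod_ne_zero_iff.mpr fun i _ => ?_) hv0) h1
    rcases lt_or_ge (i : ℕ) j with hi | hi
    · simp [hlt i hi]
    · simpa [hge i hi] using ht i
  · rw [avgOp_ofC]
    congr 1
    ext1 k
    have : ∀ s, φ (glue j s k) = φ k := fun s => Finset.prod_congr rfl fun i _ => by
      rcases lt_or_ge (i : ℕ) j with hi | hi
      · simp [hlt i hi]
      · rw [glue_apply_of_le j s k hi]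
    simp [avgC_apply, hfk, this]
  · rw [avgOp_ofC, ← map_zero (ofC (N := N) (M := M))]
    congr 1
    ext1 k
    simp only [avgC_apply, hfk, ContinuousMap.zero_apply]
    rw [integral_smul_const]
    set q : Fin N → unitInterval → ℂ := fun i x =>
      if (i : ℕ) < r then h i x else h i (k i) with hq
    have h1 : ∀ s, φ (glue r s k) = ∏ i, q i (s i) := fun s =>
      Finset.prod_congr rfl fun i _ => by
        by_cases hi : (i : ℕ) < r <;> simp [hq, glue, hi]
    -- The coordinate of index `j` is among the first `r` and carries a mean-zero factor; one
    -- vanishing factor suffices.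
    have h2 : ∫ x, q ⟨j, by omega⟩ x = 0 := by
      simp only [hq, hr, if_true]
      rw [hge _ le_rfl]
      exact hg0 _
    rw [integral_congr_ae (.of_forall h1), integral_fintype_prod_volume_eq_prod q,
      Finset.prod_eq_zero (Finset.mem_univ (⟨j, by omega⟩ : Fin N)) h2, zero_smul]
  · rw [mulOp_ofC]
    refine Lp.norm_le_mul_norm_of_ae_le_mul ?_
    filter_upwards [ofC_ae f, ofC_ae (mulC B f)] with k h1 h2
    rw [h1, h2, mulC_apply, hfk, map_smul, norm_smul, norm_smul]
    rcases eq_or_ne (φ k) 0 with h0 | h0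
    · simp [h0]
    have hne := Finset.prod_ne_zero_iff.mp h0
    -- The test function is localized only in the later variables. Resetting the first `j` to those
    -- of `k₀` leaves `B` unchanged and brings the point within `δ` of `k₀`.
    have hBk : B k = B (glue j k₀ k) := hB fun i hi => (glue_apply_of_le j k₀ k hi).symm
    have hd : dist (glue j k₀ k) k₀ < δ := by
      rw [dist_pi_lt_iff hδ]
      intro i
      rcases lt_or_ge (i : ℕ) j with hi | hi
      · simpa [glue, hi] using hδ
      · rw [glue_apply_of_le j k₀ k hi]
        exact hgs i _ (hge i hi ▸ hne i (Finset.mem_univ i))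
    have h3 := hδB hd
    rw [hBv, dist_zero_right] at h3
    rw [hBk]
    calc _ ≤ ‖φ k‖ * (ε * ‖v‖) := by gcongr
      _ = _ := by ring

end TestFunctions

/-! ### The Woodbury identity in a ring -/

section Woodbury

variable {𝓡 : Type*} [Ring 𝓡] {T T' P A S G : 𝓡}

/-- Since `A` commutes with the projection, a second `P` can be inserted between `T'` and `A`, which
exposes the compression of `T'`. -/
lemma compression_mul (hP : P * P = P) (hPA : P * A = A * P) (hS : P * T' * P = S * P) :
    P * T' * A * P = S * A * P :=
  calc P * T' * A * P = P * T' * (A * P) * P := by simp only [mul_assoc, hP]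
    _ = P * T' * P * A * P := by rw [← hPA]; simp only [mul_assoc]
    _ = S * (P * A) * P := by rw [hS]; simp only [mul_assoc]
    _ = S * A * P := by rw [hPA]; simp only [mul_assoc, hP]

/-- The Woodbury identity for a perturbation `A * P` with a projection `P` that commutes with `A`,
together with the compression of the new inverse to the range of `P`. -/
lemma woodbury_of_compression {G' : 𝓡} (hT : T * T' = 1) (hT' : T' * T = 1) (hP : P * P = P)
    (hPA : P * A = A * P) (hPG' : P * G' = G' * P) (hS : P * T' * P = S * P)
    (hG : (1 + S * A) * G' = 1) (hG' : G' * (1 + S * A) = 1) :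
    (T + A * P) * (T' - T' * A * G' * P * T') = 1 ∧
    (T' - T' * A * G' * P * T') * (T + A * P) = 1 ∧
    P * (T' - T' * A * G' * P * T') * P = G' * S * P := by
  have h1 : P * T' * A * P = S * A * P := compression_mul hP hPA hS
  have h2 : P * T' * A * G' * P = S * A * G' * P := by
    rw [mul_assoc _ G', ← hPG', ← mul_assoc, h1, mul_assoc _ P, hPG', ← mul_assoc]
  have hG1 : S * A * G' = 1 - G' := by rw [← hG]; noncomm_ring
  have hG2 : G' * S * A = 1 - G' := by rw [← hG']; noncomm_ring
  have hPSP : P * S * P = S * P := by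
    rw [mul_assoc, ← hS]; simp only [← mul_assoc, hP]
  refine ⟨?_, ?_, ?_⟩
  · calc _ = T * T' - (T * T') * A * G' * P * T' + A * P * T'
          - A * (P * T' * A * G' * P) * T' := by noncomm_ring
      _ = 1 := by rw [h2, hT, hG1]; noncomm_ring
  · calc _ = T' * T + T' * A * P - T' * A * G' * P * (T' * T)
          - T' * A * G' * (P * T' * A * P) := by noncomm_ring
      _ = T' * T + T' * A * P - T' * A * G' * P * (T' * T)
          - T' * A * (G' * S * A) * P := by rw [h1]; noncomm_ring
      _ = 1 := by rw [hT', hG2]; noncomm_ring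
  · calc _ = P * T' * P - (P * T' * A * G' * P) * T' * P := by noncomm_ring
      _ = P * T' * P - S * A * G' * (P * T' * P) := by rw [h2]; noncomm_ring
      _ = G' * S * P := by rw [hS, hG1]; noncomm_ring

end Woodbury

/-! ### Partial operators and their inverses -/

section Spectrum

variable {N M : ℕ}

lemma _root_.Continuous.matrix_inv_of_isUnit {X n : Type*} [TopologicalSpace X] [Fintype n]
    [DecidableEq n] {B : X → Matrix n n ℂ} (hB : Continuous B) (h : ∀ x, IsUnit (B x)) :
    Continuous fun x => (B x)⁻¹ := by
  simp only [Matrix.inv_def, Ring.inverse_eq_inv']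
  exact (hB.matrix_det.inv₀ fun x =>
    ((Matrix.isUnit_iff_isUnit_det _).mp (h x)).ne_zero).smul hB.matrix_adjugate

variable (A : Fin (N + 1) → C(Cube N, Matrix (Fin M) (Fin M) ℂ)) (z : ℂ)

lemma invF_zero (k : Cube N) : invF A z 0 k = (G A z 0 k)⁻¹ := rfl

lemma invF_succ (i : Fin N) (k : Cube N) :
    invF A z i.succ k = (G A z i.succ k)⁻¹ * coordAvg i (invF A z i.castSucc) k := rfl

lemma G_zero (k : Cube N) : G A z 0 k = A 0 k - z • 1 := rfl

lemma G_succ (i : Fin N) (k : Cube N) :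
    G A z i.succ k = 1 + coordAvg i (invF A z i.castSucc) k * A i.succ k := rfl

lemma F_succ (i : Fin N) (k : Cube N) :
    F A z i.succ k =
      A i.succ k + (coordAvg i (fun k' => (F A z i.castSucc k')⁻¹) k)⁻¹ := rfl

/-- The operator `A₀ - z + A₁ ⟨·⟩_{1,1} + … + A_n ⟨·⟩_{1,n}`. -/
def partialOp (n : ℕ) : L2 N M →L[ℂ] L2 N M :=
  mulOp (A 0 - z • 1) +
    ∑ i ∈ Finset.univ.filter (fun l : Fin N => (l : ℕ) < n),
      mulOp (A i.succ) * avgOp ((i : ℕ) + 1)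

lemma partialOp_zero : partialOp A z 0 = mulOp (A 0 - z • 1) := by
  simp [partialOp]

lemma partialOp_succ (i : Fin N) :
    partialOp A z ((i : ℕ) + 1) =
      partialOp A z i + mulOp (A i.succ) * avgOp ((i : ℕ) + 1) := by
  have h : (Finset.univ.filter fun l : Fin N => (l : ℕ) < (i : ℕ) + 1) =
      insert i (Finset.univ.filter fun l : Fin N => (l : ℕ) < i) := by
    ext l
    simp only [Finset.mem_filter, Finset.mem_univ, true_and, Finset.mem_insert, Fin.ext_iff]
    omega
  rw [partialOp, h, Finset.sum_insert (by simp), partialOp]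
  abel

lemma partialOp_last : partialOp A z N = defectOp A - algebraMap ℂ _ z := by
  have h : (Finset.univ.filter fun l : Fin N => (l : ℕ) < N) = Finset.univ := by
    ext l; simp
  rw [partialOp, h, mulOp_sub, mulOp_smul, mulOp_one, Algebra.algebraMap_eq_smul_one, defectOp]
  simp only [ContinuousLinearMap.mul_def]
  abel

lemma partialOp_last_eq_add (j : ℕ) :
    partialOp A z N = partialOp A z j +
      ∑ i ∈ Finset.univ.filter (fun l : Fin N => j ≤ (l : ℕ)),
        mulOp (A i.succ) * avgOp ((i : ℕ) + 1) := by
  have h : (Finset.univ.filter fun l : Fin N => (l : ℕ) < N) = Finset.univ := by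
    ext l; simp
  rw [partialOp, partialOp, h, add_assoc,
    ← Finset.sum_filter_add_sum_filter_not Finset.univ (fun l : Fin N => (l : ℕ) < j)]
  simp only [not_lt]

variable {A} {z}

/-- The compression of an operator to the functions of the variables after the first `i + 1`,
when its compression to those of the variables after the first `i` is a multiplication. -/
lemma compression_avg {T' : L2 N M →L[ℂ] L2 N M} (i : Fin N)
    {R S : C(Cube N, Matrix (Fin M) (Fin M) ℂ)}
    (hd : DependsOn R {l : Fin N | (i : ℕ) ≤ l})
    (hR : avgOp (i : ℕ) * T' * avgOp (i : ℕ) = mulOp R * avgOp (i : ℕ))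
    (hS : ∀ k, S k = coordAvg i R k) :
    avgOp ((i : ℕ) + 1) * T' * avgOp ((i : ℕ) + 1) = mulOp S * avgOp ((i : ℕ) + 1) := by
  have hl : avgOp (N := N) (M := M) ((i : ℕ) + 1) = avgOp ((i : ℕ) + 1) * avgOp (i : ℕ) :=
    (avgOp_mul_of_ge (Nat.le_succ _)).symm
  have hr : avgOp (N := N) (M := M) ((i : ℕ) + 1) = avgOp (i : ℕ) * avgOp ((i : ℕ) + 1) :=
    (avgOp_mul_of_le (Nat.le_succ _)).symm
  -- Compress in two stages: the shorter average turns `T'` into multiplication by `R`, the longer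
  -- one then averages `R` over one variable.
  rw [← avgOp_mul_mulOp_mul_avgOp i hd hS]
  calc avgOp ((i : ℕ) + 1) * T' * avgOp ((i : ℕ) + 1)
      = avgOp ((i : ℕ) + 1) * avgOp (i : ℕ) * T' *
          (avgOp (i : ℕ) * avgOp ((i : ℕ) + 1)) := by rw [← hl, ← hr]
    _ = avgOp ((i : ℕ) + 1) * (avgOp (i : ℕ) * T' * avgOp (i : ℕ)) *
          avgOp ((i : ℕ) + 1) := by simp only [mul_assoc]
    _ = avgOp ((i : ℕ) + 1) * mulOp R * (avgOp (i : ℕ) * avgOp ((i : ℕ) + 1)) := by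
        rw [hR]; simp only [mul_assoc]
    _ = _ := by rw [← hr]

lemma dependsOn_G_zero
    (hA : ∀ j : Fin (N + 1), DependsOn (A j) {i : Fin N | (j : ℕ) ≤ (i : ℕ)}) :
    DependsOn (G A z 0) {i : Fin N | 0 ≤ (i : ℕ)} := fun k k' h => by
  rw [G_zero, G_zero, hA 0 h]

lemma dependsOn_G_succ
    (hA : ∀ j : Fin (N + 1), DependsOn (A j) {i : Fin N | (j : ℕ) ≤ (i : ℕ)}) {i : Fin N}
    (h : DependsOn (invF A z i.castSucc) {l : Fin N | (i : ℕ) ≤ l}) :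
    DependsOn (G A z i.succ) {l : Fin N | (i : ℕ) + 1 ≤ l} := fun k k' hk => by
  rw [G_succ, G_succ, dependsOn_coordAvg h hk, hA i.succ (by simpa using hk)]

/-- If `G_0, …, G_j` are invertible, then so is the partial operator of index `j`, and its inverse
compresses to multiplication by `F_j⁻¹` on the functions of the last `N - j` variables. -/
lemma partialOp_inverse
    (hA : ∀ j : Fin (N + 1), DependsOn (A j) {i : Fin N | (j : ℕ) ≤ (i : ℕ)})
    (j : Fin (N + 1)) (hG : ∀ r ≤ j, ∀ k, IsUnit (G A z r k)) :
    Continuous (invF A z j) ∧ DependsOn (invF A z j) {i : Fin N | (j : ℕ) ≤ (i : ℕ)} ∧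
    ∃ T' : L2 N M →L[ℂ] L2 N M, partialOp A z j * T' = 1 ∧ T' * partialOp A z j = 1 ∧
      ∀ R : C(Cube N, Matrix (Fin M) (Fin M) ℂ), (∀ k, R k = invF A z j k) →
        avgOp j * T' * avgOp j = mulOp R * avgOp j := by
  induction j using Fin.induction with
  | zero =>
    have hu := hG 0 le_rfl
    have hc : Continuous (invF A z 0) :=
      Continuous.matrix_inv_of_isUnit (A 0 - z • 1 : C(Cube N, _)).continuous hu
    refine ⟨hc, fun k k' h => ?_, mulOp ⟨_, hc⟩, ?_, ?_, fun R hR => ?_⟩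
    · rw [invF_zero, invF_zero, dependsOn_G_zero hA h]
    · rw [Fin.val_zero, partialOp_zero, ← mulOp_mul, ← mulOp_one]
      congr 1
      ext1 k
      exact Matrix.mul_nonsing_inv _ ((Matrix.isUnit_iff_isUnit_det _).mp (hu k))
    · rw [Fin.val_zero, partialOp_zero, ← mulOp_mul, ← mulOp_one]
      congr 1
      ext1 k
      exact Matrix.nonsing_inv_mul _ ((Matrix.isUnit_iff_isUnit_det _).mp (hu k))
    · have : R = ⟨_, hc⟩ := ContinuousMap.ext hR
      simp [this, avgOp_zero]
  | succ i ih =>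
    obtain ⟨hc, hd, T', hT, hT', hR⟩ := ih fun r hr => hG r (hr.trans (Fin.castSucc_lt_succ).le)
    have hu := hG i.succ le_rfl
    simp only [Fin.val_castSucc] at hd hT hT' hR
    set S : C(Cube N, Matrix (Fin M) (Fin M) ℂ) := ⟨_, continuous_coordAvg i hc⟩ with hS
    set B : C(Cube N, Matrix (Fin M) (Fin M) ℂ) := 1 + S * A i.succ with hB
    have hci : Continuous fun k => (B k)⁻¹ := Continuous.matrix_inv_of_isUnit B.continuous hu
    set B' : C(Cube N, Matrix (Fin M) (Fin M) ℂ) := ⟨_, hci⟩ with hB'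
    have hGd := dependsOn_G_succ hA hd
    have hB'd : DependsOn B' {l : Fin N | (i : ℕ) + 1 ≤ l} := fun k k' h => by
      change (G A z i.succ k)⁻¹ = (G A z i.succ k')⁻¹
      rw [hGd h]
    have hBB' : (1 + mulOp S * mulOp (A i.succ)) * mulOp B' = 1 := by
      rw [← mulOp_mul, ← mulOp_one, ← mulOp_add, ← mulOp_mul]
      congr 1
      ext1 k
      exact Matrix.mul_nonsing_inv _ ((Matrix.isUnit_iff_isUnit_det _).mp (hu k))
    have hB'B : mulOp B' * (1 + mulOp S * mulOp (A i.succ)) = 1 := by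
      rw [← mulOp_mul, ← mulOp_one, ← mulOp_add, ← mulOp_mul]
      congr 1
      ext1 k
      exact Matrix.nonsing_inv_mul _ ((Matrix.isUnit_iff_isUnit_det _).mp (hu k))
    have hAd : DependsOn (A i.succ) {l : Fin N | (i : ℕ) + 1 ≤ l} := by simpa using hA i.succ
    -- The perturbation is `A_{i+1} P_{i+1}`; `B` is `G_{i+1}`, and the compressed new inverse `B' *
    -- S` is `F_{i+1}⁻¹`.
    obtain ⟨h1, h2, h3⟩ := woodbury_of_compression hT hT' (avgOp_mul_of_le le_rfl)
      (avgOp_mul_mulOp hAd) (avgOp_mul_mulOp hB'd)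
      (compression_avg i hd (hR ⟨_, hc⟩ fun _ => rfl) fun _ => rfl) hBB' hB'B
    refine ⟨hci.mul S.continuous, fun k k' h => ?_,
      T' - T' * mulOp (A i.succ) * mulOp B' * avgOp ((i : ℕ) + 1) * T', ?_, ?_, fun R hR => ?_⟩
    · simp only [Fin.val_succ] at h
      rw [invF_succ, invF_succ, hGd h, dependsOn_coordAvg hd h]
    · rw [Fin.val_succ, partialOp_succ]
      exact h1
    · rw [Fin.val_succ, partialOp_succ]
      exact h2
    · have : R = B' * S := ContinuousMap.ext hR
      rw [this, mulOp_mul, Fin.val_succ]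
      exact h3

end Spectrum

/-! ### Singular `G_j`, the spectrum, and the literal fractions -/

section MainTheorem

variable {N M : ℕ} {A : Fin (N + 1) → C(Cube N, Matrix (Fin M) (Fin M) ℂ)} {z : ℂ}

/-- The equation for the partial operator of index `j` reduces to multiplication by `G_j`. -/
lemma exists_reduction
    (hA : ∀ j : Fin (N + 1), DependsOn (A j) {i : Fin N | (j : ℕ) ≤ (i : ℕ)})
    (j : Fin (N + 1)) (hG : ∀ r < j, ∀ k, IsUnit (G A z r k)) :
    ∃ B : C(Cube N, Matrix (Fin M) (Fin M) ℂ), (∀ k, B k = G A z j k) ∧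
      DependsOn B {i : Fin N | (j : ℕ) ≤ (i : ℕ)} ∧
      ∃ W V V' : L2 N M →L[ℂ] L2 N M,
        partialOp A z j * W * avgOp j = V * mulOp B * avgOp j ∧
        avgOp j * W * avgOp j = avgOp j - V' * mulOp B * avgOp j := by
  induction j using Fin.cases with
  | zero =>
    refine ⟨A 0 - z • 1, fun k => rfl, dependsOn_G_zero hA, 1, 1, 0, ?_, ?_⟩
    · simp [partialOp_zero]
    · simp [avgOp_zero]
  | succ i =>
    obtain ⟨hc, hd, T', hT, hT', hR⟩ := partialOp_inverse hA i.castSucc fun r hr =>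
      hG r (hr.trans_lt Fin.castSucc_lt_succ)
    simp only [Fin.val_castSucc] at hd hT hT' hR
    set S : C(Cube N, Matrix (Fin M) (Fin M) ℂ) := ⟨_, continuous_coordAvg i hc⟩ with hS
    have hAd : DependsOn (A i.succ) {l : Fin N | (i : ℕ) + 1 ≤ l} := by simpa using hA i.succ
    have hPA := avgOp_mul_mulOp hAd
    have hPP : avgOp (N := N) (M := M) ((i : ℕ) + 1) * avgOp ((i : ℕ) + 1) = _ :=
      avgOp_mul_of_le le_rfl
    have h1 := compression_mul hPP hPA
      (compression_avg i hd (hR ⟨_, hc⟩ fun _ => rfl) (S := S) fun _ => rfl)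
    -- With `P` the average over `i + 1` variables and `u = P u`, put `W u = -T' A u`. Then `P W u =
    -- -S A u = u - B u`, and `(T + A P) W u = -A u - A S A u = -A B u`.
    refine ⟨1 + S * A i.succ, fun k => rfl, dependsOn_G_succ hA hd, -(T' * mulOp (A i.succ)),
      -mulOp (A i.succ), 1, ?_, ?_⟩
    · rw [Fin.val_succ, partialOp_succ, mulOp_add, mulOp_mul, mulOp_one]
      calc _ = -(partialOp A z i * T') * mulOp (A i.succ) * avgOp ((i : ℕ) + 1) -
            mulOp (A i.succ) *
              (avgOp ((i : ℕ) + 1) * T' * mulOp (A i.succ) * avgOp ((i : ℕ) + 1)) := by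
            noncomm_ring
        _ = _ := by rw [hT, h1]; noncomm_ring
    · rw [Fin.val_succ, mulOp_add, mulOp_mul, mulOp_one]
      calc _ = -(avgOp ((i : ℕ) + 1) * T' * mulOp (A i.succ) * avgOp ((i : ℕ) + 1)) := by
            noncomm_ring
        _ = _ := by rw [h1]; noncomm_ring

/-- If `G_0, …, G_{j-1}` are invertible and `G_j` is singular at a point, then `𝒜 - z` is not
invertible. -/
lemma not_isUnit_partialOp_last
    (hA : ∀ j : Fin (N + 1), DependsOn (A j) {i : Fin N | (j : ℕ) ≤ (i : ℕ)})
    (j : Fin (N + 1)) (hG : ∀ r < j, ∀ k, IsUnit (G A z r k)) {k₀ : Cube N}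
    (hdet : (G A z j k₀).det = 0) : ¬ IsUnit (partialOp A z N) := by
  intro hu
  obtain ⟨B, hB, hBd, W, V, V', hTW, hPW⟩ := exists_reduction hA j hG
  obtain ⟨K, -, hK⟩ := isUnit_iff_exists.mp hu
  -- `Y` is chosen so that `T_N W u = Y B u` on the test functions. A left inverse `K` of `T_N` then
  -- gives `W u = K Y B u`, and `u = P_j W u + V' B u` yields `Z`.
  set Y : L2 N M →L[ℂ] L2 N M := V -
    ∑ i ∈ Finset.univ.filter (fun l : Fin N => (j : ℕ) ≤ (l : ℕ)),
      mulOp (A i.succ) * avgOp ((i : ℕ) + 1) * V' with hY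
  set Z : L2 N M →L[ℂ] L2 N M := avgOp j * K * Y + V' with hZ
  have key : ∀ u : L2 N M, avgOp j u = u → (∀ r, (j : ℕ) < r → r ≤ N → avgOp r u = 0) →
      u = Z (mulOp B u) := by
    intro u hu hr
    have h1 : partialOp A z j (W u) = V (mulOp B u) := by
      have := DFunLike.congr_fun hTW u
      simpa only [mul_apply_eq_comp, hu] using this
    have h2 : avgOp j (W u) = u - V' (mulOp B u) := by
      have := DFunLike.congr_fun hPW u
      simpa only [mul_apply_eq_comp, sub_apply, hu] using this
    have h3 : ∀ i : Fin N, (j : ℕ) ≤ (i : ℕ) →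
        avgOp ((i : ℕ) + 1) (W u) = -avgOp ((i : ℕ) + 1) (V' (mulOp B u)) := by
      intro i hi
      -- The longer average factors through `P_j`, where `W u` is `u - V' B u`, and it kills `u`.
      have h := DFunLike.congr_fun
        (avgOp_mul_of_ge (N := N) (M := M) (j := (i : ℕ) + 1) (r := (j : ℕ)) (by omega)) (W u)
      rw [mul_apply_eq_comp] at h
      rw [← h, h2, map_sub, hr _ (by omega) (by omega), zero_sub]
    have h4 : partialOp A z N (W u) = Y (mulOp B u) := by
      rw [partialOp_last_eq_add A z j, add_apply, h1, hY, sub_apply,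
        sub_eq_add_neg, sum_apply, sum_apply,
        ← Finset.sum_neg_distrib]
      congr 1
      refine Finset.sum_congr rfl fun i hi => ?_
      simp only [mul_apply_eq_comp]
      rw [h3 i (Finset.mem_filter.mp hi).2, map_neg]
    have h5 : W u = K (Y (mulOp B u)) := by
      rw [← h4, ← mul_apply_eq_comp, hK, one_apply_eq_self]
    rw [hZ, add_apply, mul_apply_eq_comp, mul_apply_eq_comp, ← h5, h2, sub_add_cancel]
  -- This `ε` makes `‖Z‖ * ε < 1`, which contradicts `u = Z (B u)` with `u ≠ 0`; the `+ 1` covers `Z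
  -- = 0`.
  obtain ⟨u, hu0, hju, hru, hle⟩ := exists_norm_mulOp_le hBd (k₀ := k₀) (by rw [hB, hdet])
    (ε := (‖Z‖ + 1)⁻¹) (by positivity)
  have hpos : 0 < ‖u‖ := norm_pos_iff.mpr hu0
  have h6 : ‖u‖ ≤ ‖Z‖ * ((‖Z‖ + 1)⁻¹ * ‖u‖) :=
    calc ‖u‖ = ‖Z (mulOp B u)‖ := by rw [← key u hju hru]
      _ ≤ ‖Z‖ * ‖mulOp B u‖ := Z.le_opNorm _
      _ ≤ _ := by gcongr
  have h7 : ‖Z‖ * ((‖Z‖ + 1)⁻¹ * ‖u‖) < ‖u‖ := by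
    rw [← mul_assoc, ← div_eq_mul_inv]
    exact mul_lt_of_lt_one_left hpos ((div_lt_one (by positivity)).mpr (lt_add_one _))
  exact absurd h6 (not_le.mpr h7)

/-- Membership in `sigma A r` also demands that all earlier determinants be nonzero, so `z ∉ sigma A
r` says something about `G_r` only once these are known; hence strong induction. -/
lemma isUnit_G_of_notMem_sigma (j : Fin (N + 1)) (h : ∀ r ≤ j, z ∉ sigma A r) :
    ∀ r ≤ j, ∀ k, IsUnit (G A z r k) := by
  intro r
  induction r using WellFoundedLT.induction with
  | ind r ih =>
    intro hr k
    rw [Matrix.isUnit_iff_isUnit_det, isUnit_iff_ne_zero]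
    intro h0
    refine h r hr ⟨fun s hs k' => ?_, k, h0⟩
    exact ((Matrix.isUnit_iff_isUnit_det _).mp (ih s hs (hs.le.trans hr) k')).ne_zero

theorem spectrum_defectOp
    (hA : ∀ j : Fin (N + 1), DependsOn (A j) {i : Fin N | (j : ℕ) ≤ (i : ℕ)}) :
    spectrum ℂ (defectOp A) = ⋃ j : Fin (N + 1), sigma A j := by
  ext z
  have hspec : z ∈ spectrum ℂ (defectOp A) ↔ ¬ IsUnit (partialOp A z N) := by
    rw [spectrum.mem_iff, partialOp_last, IsUnit.sub_iff]
  rw [hspec, Set.mem_iUnion]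
  constructor
  · intro h
    by_contra! hs
    have hG := isUnit_G_of_notMem_sigma (Fin.last N) fun r _ => hs r
    obtain ⟨-, -, T', h1, h2, -⟩ := partialOp_inverse hA (Fin.last N) hG
    exact h (isUnit_iff_exists.mpr ⟨T', h1, h2⟩)
  · rintro ⟨j, hj, k, hk⟩
    exact not_isUnit_partialOp_last hA j (fun r hr k => (Matrix.isUnit_iff_isUnit_det _).mpr
      (isUnit_iff_ne_zero.mpr (hj r hr k))) hk

/-- As long as no singular average has to be inverted, the literal fractions are invertible and
have the inverses `invF`. -/
lemma isUnit_F_and_invF_eq (i : Fin (N + 1)) (hG : ∀ r ≤ i, ∀ k, IsUnit (G A z r k))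
    (hS : ∀ r : Fin N, r.castSucc < i → ∀ k,
      IsUnit (coordAvg r (fun k' => (F A z r.castSucc k')⁻¹) k)) (k : Cube N) :
    IsUnit (F A z i k) ∧ invF A z i k = (F A z i k)⁻¹ := by
  induction i using Fin.induction generalizing k with
  | zero => exact ⟨hG 0 le_rfl k, rfl⟩
  | succ i ih =>
    have hlt : i.castSucc < i.succ := Fin.castSucc_lt_succ
    have h := ih (fun r hr => hG r (hr.trans hlt.le)) fun r hr => hS r (hr.trans hlt)
    have he : invF A z i.castSucc = fun k' => (F A z i.castSucc k')⁻¹ :=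
      funext fun k' => (h k').2
    have hu := hS i hlt k
    -- The factorization `F_{i+1} = S⁻¹ G_{i+1}`, valid because `S` is invertible here.
    have hF : F A z i.succ k =
        (coordAvg i (fun k' => (F A z i.castSucc k')⁻¹) k)⁻¹ * G A z i.succ k := by
      rw [F_succ, G_succ, he, mul_add, mul_one, ← mul_assoc,
        Matrix.nonsing_inv_mul _ ((Matrix.isUnit_iff_isUnit_det _).mp hu), one_mul, add_comm]
    refine ⟨?_, ?_⟩
    · rw [hF]
      exact (Matrix.isUnit_nonsing_inv_iff.mpr hu).mul (hG _ le_rfl k)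
    · rw [hF, Matrix.mul_inv_rev,
        Matrix.nonsing_inv_nonsing_inv _ ((Matrix.isUnit_iff_isUnit_det _).mp hu), invF_succ, he]

end MainTheorem

end ContinuedFraction

end

theorem theorem1 (N M : ℕ)
    (A : Fin (N + 1) → C(ContinuedFraction.Cube N, Matrix (Fin M) (Fin M) ℂ))
    (hA : ∀ (j : Fin (N + 1)) (k k' : ContinuedFraction.Cube N),
      (∀ i : Fin N, (j : ℕ) ≤ (i : ℕ) → k i = k' i) → A j k = A j k') :
    -- the spectrum is the union of the components
    (spectrum ℂ (ContinuedFraction.defectOp A) =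
      ⋃ j : Fin (N + 1), ContinuedFraction.sigma A j) ∧
    -- outside `σ_0, …, σ_j` the inverse fraction `F_j⁻¹` is well defined and continuous
    (∀ (z : ℂ) (j : Fin (N + 1)),
      (∀ r ≤ j, z ∉ ContinuedFraction.sigma A r) →
      (∀ r ≤ j, ∀ k, IsUnit (ContinuedFraction.G A z r k)) ∧
      Continuous (ContinuedFraction.invF A z j)) ∧
    -- where no singular average has to be inverted, everything agrees with the literal fractions
    (∀ (z : ℂ) (i : Fin N),
      (∀ r ≤ i.castSucc, z ∉ ContinuedFraction.sigma A r) →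
      (∀ r < i, ∀ k, IsUnit (ContinuedFraction.coordAvg r
        (fun k' => (ContinuedFraction.F A z r.castSucc k')⁻¹) k)) →
      ∀ k, IsUnit (ContinuedFraction.F A z i.castSucc k) ∧
        ContinuedFraction.invF A z i.castSucc k = (ContinuedFraction.F A z i.castSucc k)⁻¹ ∧
        ContinuedFraction.G A z i.succ k =
          1 + ContinuedFraction.coordAvg i
            (fun k' => (ContinuedFraction.F A z i.castSucc k')⁻¹) k * A i.succ k ∧
        (IsUnit (ContinuedFraction.coordAvg i
            (fun k' => (ContinuedFraction.F A z i.castSucc k')⁻¹) k) →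
          ContinuedFraction.G A z i.succ k =
            ContinuedFraction.coordAvg i
              (fun k' => (ContinuedFraction.F A z i.castSucc k')⁻¹) k *
                ContinuedFraction.F A z i.succ k)) := by
  have hA' : ∀ j : Fin (N + 1), DependsOn (A j) {i : Fin N | (j : ℕ) ≤ (i : ℕ)} :=
    fun j k k' h => hA j k k' h
  refine ⟨ContinuedFraction.spectrum_defectOp hA', fun z j hz => ?_, fun z i hz hS k => ?_⟩
  · have hG := ContinuedFraction.isUnit_G_of_notMem_sigma j hz
    exact ⟨hG, (ContinuedFraction.partialOp_inverse hA' j hG).1⟩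
  · have hG := ContinuedFraction.isUnit_G_of_notMem_sigma i.castSucc hz
    have h := ContinuedFraction.isUnit_F_and_invF_eq i.castSucc hG
      fun r hr => hS r (Fin.castSucc_lt_castSucc_iff.mp hr)
    have he : ContinuedFraction.invF A z i.castSucc =
        fun k' => (ContinuedFraction.F A z i.castSucc k')⁻¹ := funext fun k' => (h k').2
    have hGk := ContinuedFraction.G_succ A z i k
    rw [he] at hGk
    refine ⟨(h k).1, (h k).2, hGk, fun hu => ?_⟩
    rw [hGk, ContinuedFraction.F_succ, mul_add,
      Matrix.mul_nonsing_inv _ ((Matrix.isUnit_iff_isUnit_det _).mp hu), add_comm]
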